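/- **Theorem (Filtration Theorem).** Fix a countably infinite set $\mathsf P$ of propositional variables. The formulas of the continuous modal $\mu$-calculus $\mu_c\mathsf{ML}$ and, for $X\subseteq\mathsf P$, its fragments $\mathsf{Con}_X$ and $\mathsf{Cocon}_X$ are defined by simultaneous induction: $$\mu_c\mathsf{ML}:\quad \varphi ::= p \mid \neg p \mid \varphi\lor\varphi \mid \varphi\land\varphi \mid \Diamond\varphi \mid \Box\varphi \mid \mu x.\varphi' \mid \nu x.\varphi'',\qquad \varphi'\in\mathsf{Con}_{\{x\}},\ \varphi''\in\mathsf{Cocon}_{\{x\}};$$ $$\mathsf{Con}_X:\quad \varphi ::= x \mid \alpha \mid \varphi\lor\varphi \mid \varphi\land\varphi \mid \Diamond\varphi \mid \mu y.\varphi',\qquad \varphi'\in\mathsf{Con}_{X\cup\{y\}};$$ $$\mathsf{Cocon}_X:\quad \varphi ::= x \mid \alpha \mid \varphi\lor\varphi \mid \varphi\land\varphi \mid \Box\varphi \mid \nu y.\varphi',\qquad \varphi'\in\mathsf{Cocon}_{X\cup\{y\}};$$ where $p,y\in\mathsf P$, $x\in\mathsf P$ in the first line and $x\in X$ in the other two,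 and $\alpha\in\mu_c\mathsf{ML}$ has no free variable in $X$. Formulas are interpreted in Kripke models $\mathbb S=(S,R,V)$ as usual, $\mu x.\varphi$ and $\nu x.\varphi$ being the intersection of all $X\subseteq S$ with $[\![\varphi]\!]^{\mathbb S[x\mapsto X]}\subseteq X$ and the union of all $X\subseteq S$ with $X\subseteq[\![\varphi]\!]^{\mathbb S[x\mapsto X]}$, respectively. A formula is *tidy* if no variable is both free and bound in it, and *clean* if it is tidy and for each of its bound variables $x$ there are a unique $\eta\in\{\mu,\nu\}$ and a unique formula $\delta$ such that $\eta x.\delta$ is a subformula. A set $\Sigma$ of formulas is *FL-closed* if: $\neg p\in\Sigma$ implies $p\in\Sigma$; $\varphi\lor\psi\in\Sigma$ or $\varphi\land\psi\in\Sigma$ implies $\varphi,\psi\in\Sigma$; $\Diamond\varphi\in\Sigma$ or $\Box\varphi\in\Sigma$ implies $\varphi\in\Sigma$; and $\eta x.\varphi\in\Sigma$ implies $\varphi[\eta x.\varphi/x]\in\Sigma$. It is *$\sim$-closed* if $\varphi\in\Sigma$ implies ${\sim}\varphi\in\Sigma$, where ${\sim}$ is negation in negation normal form: it dualises all connectives,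 modalities, binders and literals, except that bound occurrences of variables keep their polarity. Let $\Sigma$ be a finite FL-closed set of tidy $\mu_c\mathsf{ML}$-formulas and $\mathbb S=(S,R,V)$ a Kripke model. Let $\overline s$ denote the class of $s$ for the equivalence relation on $S$ of satisfying the same formulas of $\Sigma$. Let $\overline{\mathbb S}=(\overline S,\overline R,\overline V)$ be a filtration of $\mathbb S$ through $\Sigma$, that is, a Kripke model such that $\overline S$ is the set of these classes, $\overline V(p)=\{\overline s: \mathbb S,s\Vdash p\}$ for every propositional variable $p\in\Sigma$, and $R^{\min}\subseteq\overline R\subseteq R^{\max}$, where $$R^{\min}=\{(\overline s,\overline t): sRt\},\qquad R^{\max}=\{(\overline s,\overline t): \text{for all } \Box\varphi\in\Sigma,\ \mathbb S,s\Vdash\Box\varphi \text{ implies } \mathbb S,t\Vdash\varphi\}.$$ Let $\xi\in\Sigma$ be clean. Then for every $s\in S$ $$\mathbb S,s\Vdash\xi\ \Longrightarrow\ \overline{\mathbb S},\overline s\Vdash\xi .$$ If moreover $\Sigma$ is $\sim$-closed or, alternatively, $\overline R$ satisfies the dual bound $$\overline R\subseteq\{(\overline s,\overline t): \text{for all } \Diamond\varphi\in\Sigma,\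 \mathbb S,t\Vdash\varphi \text{ implies } \mathbb S,s\Vdash\Diamond\varphi\},$$ then for every $s\in S$ $$\mathbb S,s\Vdash\xi\ \Longleftrightarrow\ \overline{\mathbb S},\overline s\Vdash\xi .$$ -/

import Mathlib

namespace MuCalc

universe u v

/-- The two fixpoint binders: least (`mu`) and greatest (`nu`). -/
inductive FixOp : Type
  | mu
  | nu

/-- The dual binder. -/
def FixOp.dual : FixOp → FixOp
  | .mu => .nu
  | .nu => .mu

/-- Modal fixpoint formulas in negation normal form over the propositional variables `P`.
The continuous modal mu-calculus is carved out of these by `IsMuC` below. -/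
inductive Formula (P : Type u) : Type u
  | var (p : P)
  | nvar (p : P)
  | disj (φ ψ : Formula P)
  | conj (φ ψ : Formula P)
  | dia (φ : Formula P)
  | box (φ : Formula P)
  | fix (η : FixOp) (x : P) (φ : Formula P)

namespace Formula

variable {P : Type u}

/-- Free variables. -/
def FV : Formula P → Set P
  | var p => {p}
  | nvar p => {p}
  | disj φ ψ => FV φ ∪ FV ψ
  | conj φ ψ => FV φ ∪ FV ψ
  | dia φ => FV φ
  | box φ => FV φ
  | fix _ x φ => FV φ \ {x}

/-- Bound variables. -/
def BV : Formula P → Set P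
  | var _ => ∅
  | nvar _ => ∅
  | disj φ ψ => BV φ ∪ BV ψ
  | conj φ ψ => BV φ ∪ BV ψ
  | dia φ => BV φ
  | box φ => BV φ
  | fix _ x φ => insert x (BV φ)

/-- Subformulas. -/
def Sf : Formula P → Set (Formula P)
  | var p => {var p}
  | nvar p => {nvar p}
  | disj φ ψ => insert (disj φ ψ) (Sf φ ∪ Sf ψ)
  | conj φ ψ => insert (conj φ ψ) (Sf φ ∪ Sf ψ)
  | dia φ => insert (dia φ) (Sf φ)
  | box φ => insert (box φ) (Sf φ)
  | fix η x φ => insert (fix η x φ) (Sf φ)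

/-- No variable is both free and bound. -/
def Tidy (φ : Formula P) : Prop := Disjoint (FV φ) (BV φ)

/-- `φ` is tidy, and every bound variable `x` comes with a unique binder `η` and a unique formula
`δ` such that `η x . δ` is a subformula of `φ`. -/
def Clean (φ : Formula P) : Prop :=
  Tidy φ ∧ ∀ x ∈ BV φ, ∃! d : FixOp × Formula P, fix d.1 x d.2 ∈ Sf φ

/-- `subst x χ φ` is `φ[χ/x]`: every free occurrence of `x` in `φ` is replaced by `χ` (with
`¬ x` left in place: in the fixpoint unfoldings below, `x` has no negated free occurrence).
No renaming of binders is needed: it is only used for `φ[η x . φ / x]` with `η x . φ` tidy, where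
the free variables of `η x . φ` are not bound in `φ`. -/
def subst [DecidableEq P] (x : P) (χ : Formula P) : Formula P → Formula P
  | var p => if p = x then χ else var p
  | nvar p => nvar p
  | disj φ ψ => disj (subst x χ φ) (subst x χ ψ)
  | conj φ ψ => conj (subst x χ φ) (subst x χ ψ)
  | dia φ => dia (subst x χ φ)
  | box φ => box (subst x χ φ)
  | fix η y φ => if y = x then fix η y φ else fix η y (subst x χ φ)

/-- `flipVar x φ` is `φ[¬ x / x]`, with `¬ ¬ x` read as `x`: the polarity of every free occurrence
of `x` is reversed. -/
def flipVar [DecidableEq P] (x : P) : Formula P → Formula P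
  | var p => if p = x then nvar p else var p
  | nvar p => if p = x then var p else nvar p
  | disj φ ψ => disj (flipVar x φ) (flipVar x ψ)
  | conj φ ψ => conj (flipVar x φ) (flipVar x ψ)
  | dia φ => dia (flipVar x φ)
  | box φ => box (flipVar x φ)
  | fix η y φ => if y = x then fix η y φ else fix η y (flipVar x φ)

/-- The negation operator `∼` on formulas in negation normal form; in particular
`∼ (η x . φ)` is `η' x . (∼ φ)[¬ x / x]`, where `η'` is the dual of `η`. -/
def neg [DecidableEq P] : Formula P → Formula P
  | var p => nvar p
  | nvar p => var p
  | disj φ ψ => conj (neg φ) (neg ψ)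
  | conj φ ψ => disj (neg φ) (neg ψ)
  | dia φ => box (neg φ)
  | box φ => dia (neg φ)
  | fix η x φ => fix η.dual x (flipVar x (neg φ))

end Formula

open Formula

section Fragments

variable {P : Type u}

mutual

/-- Formulas of the continuous modal mu-calculus. -/
inductive IsMuC : Formula P → Prop
  | var (p : P) : IsMuC (var p)
  | nvar (p : P) : IsMuC (nvar p)
  | disj {φ ψ : Formula P} : IsMuC φ → IsMuC ψ → IsMuC (disj φ ψ)
  | conj {φ ψ : Formula P} : IsMuC φ → IsMuC ψ → IsMuC (conj φ ψ)
  | dia {φ : Formula P} : IsMuC φ → IsMuC (dia φ)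
  | box {φ : Formula P} : IsMuC φ → IsMuC (box φ)
  | mu {x : P} {φ : Formula P} : IsCon {x} φ → IsMuC (fix FixOp.mu x φ)
  | nu {x : P} {φ : Formula P} : IsCocon {x} φ → IsMuC (fix FixOp.nu x φ)

/-- Formulas that are continuous in the variables of `X`. -/
inductive IsCon : Set P → Formula P → Prop
  | var {X : Set P} {x : P} : x ∈ X → IsCon X (var x)
  | free {X : Set P} {α : Formula P} : IsMuC α → Disjoint (FV α) X → IsCon X α
  | disj {X : Set P} {φ ψ : Formula P} : IsCon X φ → IsCon X ψ → IsCon X (disj φ ψ)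
  | conj {X : Set P} {φ ψ : Formula P} : IsCon X φ → IsCon X ψ → IsCon X (conj φ ψ)
  | dia {X : Set P} {φ : Formula P} : IsCon X φ → IsCon X (dia φ)
  | mu {X : Set P} {y : P} {φ : Formula P} : IsCon (X ∪ {y}) φ → IsCon X (fix FixOp.mu y φ)

/-- Formulas that are cocontinuous in the variables of `X`. -/
inductive IsCocon : Set P → Formula P → Prop
  | var {X : Set P} {x : P} : x ∈ X → IsCocon X (var x)
  | free {X : Set P} {α : Formula P} : IsMuC α → Disjoint (FV α) X → IsCocon X α
  | disj {X : Set P} {φ ψ : Formula P} : IsCocon X φ → IsCocon X ψ → IsCocon X (disj φ ψ)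
  | conj {X : Set P} {φ ψ : Formula P} : IsCocon X φ → IsCocon X ψ → IsCocon X (conj φ ψ)
  | box {X : Set P} {φ : Formula P} : IsCocon X φ → IsCocon X (box φ)
  | nu {X : Set P} {y : P} {φ : Formula P} : IsCocon (X ∪ {y}) φ → IsCocon X (fix FixOp.nu y φ)

end

end Fragments

section Closure

variable {P : Type u} [DecidableEq P]

/-- The FL-closure (Fischer--Ladner closure) of a set of formulas. -/
inductive FLClosure (Φ : Set (Formula P)) : Formula P → Prop
  | base {φ : Formula P} : φ ∈ Φ → FLClosure Φ φ
  | nvar {p : P} : FLClosure Φ (nvar p) → FLClosure Φ (var p)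
  | disj_left {φ ψ : Formula P} : FLClosure Φ (disj φ ψ) → FLClosure Φ φ
  | disj_right {φ ψ : Formula P} : FLClosure Φ (disj φ ψ) → FLClosure Φ ψ
  | conj_left {φ ψ : Formula P} : FLClosure Φ (conj φ ψ) → FLClosure Φ φ
  | conj_right {φ ψ : Formula P} : FLClosure Φ (conj φ ψ) → FLClosure Φ ψ
  | dia {φ : Formula P} : FLClosure Φ (dia φ) → FLClosure Φ φ
  | box {φ : Formula P} : FLClosure Φ (box φ) → FLClosure Φ φ
  | unfold {η : FixOp} {x : P} {φ : Formula P} :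
      FLClosure Φ (fix η x φ) → FLClosure Φ (subst x (fix η x φ) φ)

/-- A set of formulas that equals its FL-closure. -/
def FLClosed (Φ : Set (Formula P)) : Prop := {φ | FLClosure Φ φ} = Φ

/-- A set of formulas that is closed under the negation operator. -/
def NegClosed (Φ : Set (Formula P)) : Prop := ∀ φ ∈ Φ, neg φ ∈ Φ

end Closure

/-- A Kripke model with set of states `S`. -/
structure KripkeModel (P : Type u) (S : Type v) : Type (max u v) where
  R : S → S → Prop
  V : P → Set S

section Semantics

variable {P : Type u} [DecidableEq P] {S : Type v}

/-- The meaning of a formula in the frame `(S, R)` under a valuation;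
`Function.update V x X` is the valuation `V[x ↦ X]`. -/
def meaning (R : S → S → Prop) : Formula P → (P → Set S) → Set S
  | var p, V => V p
  | nvar p, V => (V p)ᶜ
  | disj φ ψ, V => meaning R φ V ∪ meaning R ψ V
  | conj φ ψ, V => meaning R φ V ∩ meaning R ψ V
  | dia φ, V => {s | ∃ t, R s t ∧ t ∈ meaning R φ V}
  | box φ, V => {s | ∀ t, R s t → t ∈ meaning R φ V}
  | fix FixOp.mu x φ, V => ⋂₀ {X | meaning R φ (Function.update V x X) ⊆ X}
  | fix FixOp.nu x φ, V => ⋃₀ {X | X ⊆ meaning R φ (Function.update V x X)}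

/-- `φ` is satisfied at the state `s` of the model `M`. -/
def KripkeModel.Sat (M : KripkeModel P S) (s : S) (φ : Formula P) : Prop :=
  s ∈ meaning M.R φ M.V

/-- States are equivalent when they satisfy the same formulas of `Φ`. -/
def filtSetoid (M : KripkeModel P S) (Φ : Set (Formula P)) : Setoid S where
  r s t := ∀ φ ∈ Φ, (M.Sat s φ ↔ M.Sat t φ)
  iseqv :=
    { refl := fun _ _ _ => Iff.rfl
      symm := fun h φ hφ => (h φ hφ).symm
      trans := fun h h' φ hφ => (h φ hφ).trans (h' φ hφ) }

/-- The set of equivalence classes, i.e. the set of states of a filtration. -/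
abbrev FiltState (M : KripkeModel P S) (Φ : Set (Formula P)) : Type v :=
  Quotient (filtSetoid M Φ)

/-- The equivalence class of a state. -/
def cls (M : KripkeModel P S) (Φ : Set (Formula P)) (s : S) : FiltState M Φ :=
  Quotient.mk (filtSetoid M Φ) s

/-- The finest filtration. -/
def RMin (M : KripkeModel P S) (Φ : Set (Formula P)) (a b : FiltState M Φ) : Prop :=
  ∃ s t, cls M Φ s = a ∧ cls M Φ t = b ∧ M.R s t

/-- The coarsest filtration. For FL-closed `Φ` the condition does not depend on the chosen
representatives. -/
def RMax (M : KripkeModel P S) (Φ : Set (Formula P)) (a b : FiltState M Φ) : Prop :=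
  ∃ s t, cls M Φ s = a ∧ cls M Φ t = b ∧ ∀ φ, box φ ∈ Φ → M.Sat s (box φ) → M.Sat t φ

/-- The dual of the condition that defines the coarsest filtration. For FL-closed `Φ` it does not
depend on the chosen representatives. -/
def RMaxDia (M : KripkeModel P S) (Φ : Set (Formula P)) (a b : FiltState M Φ) : Prop :=
  ∃ s t, cls M Φ s = a ∧ cls M Φ t = b ∧ ∀ φ, dia φ ∈ Φ → M.Sat t φ → M.Sat s (dia φ)

/-- `N` is a filtration of `M` through `Φ`. -/
structure IsFiltration (M : KripkeModel P S) (Φ : Set (Formula P))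
    (N : KripkeModel P (FiltState M Φ)) : Prop where
  rmin_le : ∀ a b, RMin M Φ a b → N.R a b
  le_rmax : ∀ a b, N.R a b → RMax M Φ a b
  val : ∀ p, var p ∈ Φ → N.V p = {a | ∃ s, cls M Φ s = a ∧ M.Sat s (var p)}

end Semantics

end MuCalc

-- Both implications go by induction on the grammar, and only the fixpoints need more than the
-- classical filtration argument. Each fixpoint is handled by moving a set along the quotient map
-- `cls`, in one of two ways.
--
-- An arbitrary set of classes is pulled back. For truth going from the model to the filtration, the
-- preimage of a prefixpoint of a `mu`-body is a prefixpoint in the model; for the converse, the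
-- preimage of a postfixpoint of a `nu`-body is a postfixpoint. Nothing is known about such a set,
-- so at a modality above the fixpoint variable only `RMin` can be used. It serves diamonds going
-- forward and boxes going back, and these are exactly the modalities that `IsCon` and `IsCocon`
-- allow there.
--
-- The truth set of the fixpoint formula is pushed forward. Its image is a postfixpoint for `nu`
-- going forward and a prefixpoint for `mu` going back. Here boxes, respectively diamonds, need
-- `RMax`, respectively `RMaxDia`, which only speak of formulas of `Φ`. So the induction follows the
-- body with its fixpoint variables replaced by their unfolded binding formulas: by FL-closure these
-- instances stay in `Φ` (`Admissible`), and in the model a fixpoint is equivalent to its unfolding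
-- (`meaning_unfold`).
--
-- A subformula without free fixpoint variables is unchanged by the replacement, hence lies in `Φ`
-- itself, and the induction restarts there.

namespace MuCalc

universe u v

open Formula

-- Substitution and positive occurrences

section Substitution

variable {P : Type u} [DecidableEq P]

namespace Formula

/-- Simultaneous substitution of formulas for the free positive occurrences of variables,
without renaming of binders. -/
def msub (σ : P → Formula P) : Formula P → Formula P
  | var p => σ p
  | nvar p => nvar p
  | disj φ ψ => disj (msub σ φ) (msub σ ψ)
  | conj φ ψ => conj (msub σ φ) (msub σ ψ)
  | dia φ => dia (msub σ φ)
  | box φ => box (msub σ φ)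
  | fix η y φ => fix η y (msub (Function.update σ y (var y)) φ)

/-- `x` has no free negated occurrence in the formula. -/
def PosIn (x : P) : Formula P → Prop
  | var _ => True
  | nvar p => p ≠ x
  | disj φ ψ => PosIn x φ ∧ PosIn x ψ
  | conj φ ψ => PosIn x φ ∧ PosIn x ψ
  | dia φ => PosIn x φ
  | box φ => PosIn x φ
  | fix _ y φ => y = x ∨ PosIn x φ

theorem msub_eq_self (φ : Formula P) (σ : P → Formula P) (h : ∀ p ∈ FV φ, σ p = var p) :
    msub σ φ = φ := by
  induction φ generalizing σ with
  | var p => exact h p rfl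
  | nvar p => rfl
  | disj φ ψ ih₁ ih₂ | conj φ ψ ih₁ ih₂ =>
    simp only [msub]
    rw [ih₁ σ fun p hp => h p (Or.inl hp), ih₂ σ fun p hp => h p (Or.inr hp)]
  | dia φ ih | box φ ih =>
    simp only [msub]
    rw [ih σ h]
  | fix η y φ ih =>
    simp only [msub]
    rw [ih]
    intro p hp
    by_cases hpy : p = y
    · subst hpy; simp
    · rw [Function.update_of_ne hpy]; exact h p ⟨hp, hpy⟩

theorem subst_eq_self (φ : Formula P) (x : P) (χ : Formula P) (h : x ∉ FV φ) :
    subst x χ φ = φ := by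
  induction φ with
  | var p =>
    have : p ≠ x := fun e => h e.symm
    simp [subst, this]
  | nvar p => rfl
  | disj φ ψ ih₁ ih₂ | conj φ ψ ih₁ ih₂ =>
    simp only [subst]
    rw [ih₁ fun hp => h (Or.inl hp), ih₂ fun hp => h (Or.inr hp)]
  | dia φ ih | box φ ih =>
    simp only [subst]
    rw [ih h]
  | fix η y φ ih =>
    simp only [subst]
    split_ifs with hyx
    · rfl
    · rw [ih fun hx => h ⟨hx, fun e => hyx e.symm⟩]

/-- The hypotheses on `σ` ensure that the only free positive occurrences of `y` after `msub σ` are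
those already in `φ`, so the two substitutions merge into one. -/
theorem subst_msub (φ : Formula P) (y : P) (χ : Formula P) (σ : P → Formula P)
    (hy : σ y = var y) (h : ∀ p, p ≠ y → y ∉ FV (σ p)) :
    subst y χ (msub σ φ) = msub (Function.update σ y χ) φ := by
  induction φ generalizing σ with
  | var p =>
    by_cases hpy : p = y
    · subst hpy; simp [msub, hy, subst]
    · simp only [msub]
      rw [Function.update_of_ne hpy, subst_eq_self _ _ _ (h p hpy)]
  | nvar p => rfl
  | disj φ ψ ih₁ ih₂ | conj φ ψ ih₁ ih₂ =>
    simp only [msub, subst]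
    rw [ih₁ σ hy h, ih₂ σ hy h]
  | dia φ ih | box φ ih =>
    simp only [msub, subst]
    rw [ih σ hy h]
  | fix η z φ ih =>
    simp only [msub, subst]
    split_ifs with hzy
    · subst hzy; simp
    · rw [ih, Function.update_comm hzy]
      · rw [Function.update_of_ne (Ne.symm hzy), hy]
      · intro p hp
        by_cases hpz : p = z
        · subst hpz
          rw [Function.update_self]
          exact fun e => hp e.symm
        · rw [Function.update_of_ne hpz]; exact h p hp

theorem BV_subset_msub (φ : Formula P) (σ : P → Formula P) : BV φ ⊆ BV (msub σ φ) := by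
  induction φ generalizing σ with
  | var p => exact Set.empty_subset _
  | nvar p => exact subset_rfl
  | disj φ ψ ih₁ ih₂ | conj φ ψ ih₁ ih₂ => exact Set.union_subset_union (ih₁ σ) (ih₂ σ)
  | dia φ ih | box φ ih => exact ih σ
  | fix η y φ ih => exact Set.insert_subset_insert (ih _)

theorem posIn_of_notMem_FV {x : P} (φ : Formula P) (h : x ∉ FV φ) : PosIn x φ := by
  induction φ with
  | var p => trivial
  | nvar p => exact fun e => h e.symm
  | disj φ ψ ih₁ ih₂ | conj φ ψ ih₁ ih₂ =>
    exact ⟨ih₁ fun hp => h (Or.inl hp), ih₂ fun hp => h (Or.inr hp)⟩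
  | dia φ ih | box φ ih => exact ih h
  | fix η y φ ih =>
    by_cases hyx : y = x
    · exact Or.inl hyx
    · exact Or.inr (ih fun hx => h ⟨hx, fun e => hyx e.symm⟩)

end Formula

theorem IsCon.posIn {X : Set P} {φ : Formula P} {x : P} (hx : x ∈ X) : IsCon X φ → PosIn x φ
  | .var _ => trivial
  | .free _ hd => posIn_of_notMem_FV _ fun h => Set.disjoint_left.1 hd h hx
  | .disj h₁ h₂ => ⟨IsCon.posIn hx h₁, IsCon.posIn hx h₂⟩
  | .conj h₁ h₂ => ⟨IsCon.posIn hx h₁, IsCon.posIn hx h₂⟩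
  | .dia (φ := φ) h => show PosIn x φ from IsCon.posIn hx h
  | .mu h => Or.inr (IsCon.posIn (Or.inl hx) h)

theorem IsCocon.posIn {X : Set P} {φ : Formula P} {x : P} (hx : x ∈ X) :
    IsCocon X φ → PosIn x φ
  | .var _ => trivial
  | .free _ hd => posIn_of_notMem_FV _ fun h => Set.disjoint_left.1 hd h hx
  | .disj h₁ h₂ => ⟨IsCocon.posIn hx h₁, IsCocon.posIn hx h₂⟩
  | .conj h₁ h₂ => ⟨IsCocon.posIn hx h₁, IsCocon.posIn hx h₂⟩
  | .box (φ := φ) h => show PosIn x φ from IsCocon.posIn hx h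
  | .nu h => Or.inr (IsCocon.posIn (Or.inl hx) h)

theorem IsMuC.posIn {η : FixOp} {x : P} {φ : Formula P} (h : IsMuC (fix η x φ)) : PosIn x φ := by
  cases h with
  | mu h => exact h.posIn (Set.mem_singleton x)
  | nu h => exact h.posIn (Set.mem_singleton x)

end Substitution

-- Monotonicity, substitution, unfolding and negation in Kripke semantics

section Semantics

variable {P : Type u} [DecidableEq P] {S : Type v}

theorem meaning_congr (R : S → S → Prop) (φ : Formula P) (V W : P → Set S)
    (h : ∀ p ∈ FV φ, V p = W p) : meaning R φ V = meaning R φ W := by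
  induction φ generalizing V W with
  | var p => exact h p rfl
  | nvar p => exact congrArg compl (h p rfl)
  | disj φ ψ ih₁ ih₂ | conj φ ψ ih₁ ih₂ =>
    simp only [meaning]
    rw [ih₁ V W fun p hp => h p (Or.inl hp), ih₂ V W fun p hp => h p (Or.inr hp)]
  | dia φ ih | box φ ih =>
    simp only [meaning]
    rw [ih V W h]
  | fix η y φ ih =>
    have key : ∀ X, meaning R φ (Function.update V y X) = meaning R φ (Function.update W y X) := by
      intro X
      refine ih _ _ fun p hp => ?_
      by_cases hpy : p = y
      · subst hpy; simp
      · rw [Function.update_of_ne hpy, Function.update_of_ne hpy]; exact h p ⟨hp, hpy⟩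
    cases η <;> simp only [meaning, key]

theorem meaning_mono (R : S → S → Prop) (x : P) (φ : Formula P) (hφ : PosIn x φ)
    (V W : P → Set S) (h : ∀ p, p ≠ x → V p = W p) (hx : V x ⊆ W x) :
    meaning R φ V ⊆ meaning R φ W := by
  induction φ generalizing V W with
  | var p =>
    by_cases hp : p = x
    · subst hp; exact hx
    · exact (h p hp).subset
  | nvar p => simp only [meaning, h p hφ]; exact subset_rfl
  | disj φ ψ ih₁ ih₂ =>
    exact Set.union_subset_union (ih₁ hφ.1 V W h hx) (ih₂ hφ.2 V W h hx)
  | conj φ ψ ih₁ ih₂ =>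
    exact Set.inter_subset_inter (ih₁ hφ.1 V W h hx) (ih₂ hφ.2 V W h hx)
  | dia φ ih => exact fun s ⟨t, hst, ht⟩ => ⟨t, hst, ih hφ V W h hx ht⟩
  | box φ ih => exact fun s hs t hst => ih hφ V W h hx (hs t hst)
  | fix η y φ ih =>
    have key : ∀ X, meaning R φ (Function.update V y X) ⊆
        meaning R φ (Function.update W y X) := by
      intro X
      by_cases hyx : y = x
      · subst hyx
        have : Function.update V y X = Function.update W y X := by
          funext p
          by_cases hp : p = y
          · subst hp; simp
          · rw [Function.update_of_ne hp, Function.update_of_ne hp, h p hp]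
        rw [this]
      · refine ih (hφ.resolve_left hyx) _ _ (fun p hp => ?_) ?_
        · by_cases hpy : p = y
          · subst hpy; simp
          · rw [Function.update_of_ne hpy, Function.update_of_ne hpy, h p hp]
        · rwa [Function.update_of_ne (Ne.symm hyx), Function.update_of_ne (Ne.symm hyx)]
    cases η with
    | mu => exact fun s hs X hX => hs X ((key X).trans hX)
    | nu => exact fun s ⟨X, hX, hs⟩ => ⟨X, Set.Subset.trans hX (key X), hs⟩

theorem meaning_subst (R : S → S → Prop) (x : P) (χ φ : Formula P) (hφ : PosIn x φ)
    (hd : Disjoint (FV χ) (BV φ)) (V : P → Set S) :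
    meaning R (subst x χ φ) V = meaning R φ (Function.update V x (meaning R χ V)) := by
  induction φ generalizing V with
  | var p =>
    by_cases hp : p = x
    · subst hp; simp [subst, meaning]
    · simp [subst, meaning, hp]
  | nvar p =>
    have hp : p ≠ x := hφ
    simp [subst, meaning, hp]
  | disj φ ψ ih₁ ih₂ | conj φ ψ ih₁ ih₂ =>
    simp only [subst, meaning]
    rw [ih₁ hφ.1 (hd.mono_right Set.subset_union_left),
      ih₂ hφ.2 (hd.mono_right Set.subset_union_right)]
  | dia φ ih | box φ ih =>
    simp only [subst, meaning]
    rw [ih hφ hd]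
  | fix η y φ ih =>
    by_cases hyx : y = x
    · subst hyx
      simp only [subst, if_true]
      refine meaning_congr R _ _ _ fun p hp => ?_
      rw [Function.update_of_ne hp.2]
    · have key : ∀ X, meaning R (subst x χ φ) (Function.update V y X) =
          meaning R φ (Function.update (Function.update V x (meaning R χ V)) y X) := by
        intro X
        have hχ : meaning R χ (Function.update V y X) = meaning R χ V := by
          refine meaning_congr R _ _ _ fun p hp => Function.update_of_ne (fun e => ?_) _ _
          exact Set.disjoint_left.1 hd hp (e ▸ Set.mem_insert _ _)
        rw [ih (hφ.resolve_left hyx) (hd.mono_right (Set.subset_insert _ _)), hχ,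
          Function.update_comm hyx]
      simp only [subst, if_neg hyx]
      cases η <;> simp only [meaning, key]

theorem meaning_fix (R : S → S → Prop) (η : FixOp) (x : P) (φ : Formula P) (hφ : PosIn x φ)
    (V : P → Set S) :
    meaning R φ (Function.update V x (meaning R (fix η x φ) V)) = meaning R (fix η x φ) V := by
  -- Knaster–Tarski: the clauses of `meaning` for `mu` and `nu` are by definition the `lfp` and
  -- `gfp` of this monotone map.
  let f : Set S →o Set S :=
    { toFun := fun X => meaning R φ (Function.update V x X)
      monotone' := fun X Y hXY => by
        refine meaning_mono R x φ hφ _ _ (fun p hp => ?_) ?_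
        · rw [Function.update_of_ne hp, Function.update_of_ne hp]
        · simpa using hXY }
  cases η with
  | mu => exact f.map_lfp
  | nu => exact f.map_gfp

theorem meaning_unfold (R : S → S → Prop) (η : FixOp) (x : P) (φ : Formula P)
    (hφ : PosIn x φ) (ht : Tidy (fix η x φ)) (V : P → Set S) :
    meaning R (subst x (fix η x φ) φ) V = meaning R (fix η x φ) V := by
  rw [meaning_subst R x _ φ hφ (ht.mono_right (Set.subset_insert _ _)), meaning_fix R η x φ hφ]

theorem meaning_flipVar (R : S → S → Prop) (x : P) (φ : Formula P) (V : P → Set S) :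
    meaning R (flipVar x φ) V = meaning R φ (Function.update V x (V x)ᶜ) := by
  induction φ generalizing V with
  | var p | nvar p =>
    by_cases hp : p = x
    · subst hp; simp [flipVar, meaning]
    · simp [flipVar, meaning, hp]
  | disj φ ψ ih₁ ih₂ | conj φ ψ ih₁ ih₂ =>
    simp only [flipVar, meaning]
    rw [ih₁, ih₂]
  | dia φ ih | box φ ih =>
    simp only [flipVar, meaning]
    rw [ih]
  | fix η y φ ih =>
    by_cases hyx : y = x
    · subst hyx
      simp only [flipVar, if_true]
      refine meaning_congr R _ _ _ fun p hp => ?_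
      rw [Function.update_of_ne hp.2]
    · have key : ∀ X, meaning R (flipVar x φ) (Function.update V y X) =
          meaning R φ (Function.update (Function.update V x (V x)ᶜ) y X) := by
        intro X
        rw [ih, Function.update_comm hyx, Function.update_of_ne (Ne.symm hyx)]
      simp only [flipVar, if_neg hyx]
      cases η <;> simp only [meaning, key]

theorem meaning_neg (R : S → S → Prop) (φ : Formula P) (V : P → Set S) :
    meaning R (neg φ) V = (meaning R φ V)ᶜ := by
  induction φ generalizing V with
  | var p => rfl
  | nvar p => exact (compl_compl _).symm
  | disj φ ψ ih₁ ih₂ => simp only [neg, meaning, ih₁, ih₂, Set.compl_union]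
  | conj φ ψ ih₁ ih₂ => simp only [neg, meaning, ih₁, ih₂, Set.compl_inter]
  | dia φ ih | box φ ih =>
    ext s
    simp [neg, meaning, ih]
  | fix η x φ ih =>
    -- Negating the body and flipping `x` conjugates the body operator by complementation, so
    -- complements exchange its prefixpoints and the postfixpoints of the dual.
    have key : ∀ X, meaning R (flipVar x (neg φ)) (Function.update V x X) =
        (meaning R φ (Function.update V x Xᶜ))ᶜ := by
      intro X
      rw [meaning_flipVar, ih]
      simp
    cases η with
    | mu =>
      ext s
      simp only [neg, FixOp.dual, meaning, key, Set.mem_sUnion, Set.mem_compl_iff,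
        Set.mem_sInter, Set.mem_ofPred_eq, not_forall]
      constructor
      · rintro ⟨X, hX, hs⟩
        exact ⟨Xᶜ, Set.subset_compl_comm.1 hX, fun h => h hs⟩
      · rintro ⟨X, hX, hs⟩
        refine ⟨Xᶜ, ?_, hs⟩
        rw [compl_compl]
        exact Set.compl_subset_compl.2 hX
    | nu =>
      ext s
      simp only [neg, FixOp.dual, meaning, key, Set.mem_sUnion, Set.mem_compl_iff,
        Set.mem_sInter, Set.mem_ofPred_eq, not_exists, not_and]
      constructor
      · intro h X hX hs
        refine h Xᶜ ?_ hs
        rw [compl_compl]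
        exact Set.compl_subset_compl.2 hX
      · intro h X hX
        by_contra hs
        exact h Xᶜ (Set.compl_subset_comm.1 hX) hs

theorem KripkeModel.sat_neg (M : KripkeModel P S) (s : S) (φ : Formula P) :
    M.Sat s (neg φ) ↔ ¬ M.Sat s φ := by
  unfold KripkeModel.Sat
  rw [meaning_neg]
  rfl

end Semantics

-- Subformulas and their instances in the closed set

section Admissible

variable {P : Type u} [DecidableEq P]

/-- The formula `φ`, found below fixpoint binders of the variables in `X`, turns into a member of
`Φ` when these variables are replaced according to `σ` by their (unfolded) binding formulas. -/
structure Admissible (Φ : Set (Formula P)) (X : Set P) (σ : P → Formula P) (φ : Formula P) :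
    Prop where
  eq_var : ∀ p ∉ X, σ p = var p
  mem : ∀ p ∈ X, σ p ∈ Φ
  bv : ∀ p ∈ X, BV φ ⊆ BV (σ p)
  msub_mem : msub σ φ ∈ Φ

namespace Admissible

variable {Φ : Set (Formula P)} {X : Set P} {σ : P → Formula P} {φ ψ : Formula P}

theorem of_mem (h : φ ∈ Φ) : Admissible Φ ∅ var φ where
  eq_var _ _ := rfl
  mem _ h := h.elim
  bv _ h := h.elim
  msub_mem := by rwa [msub_eq_self φ _ fun _ _ => rfl]

theorem msub_eq_of_disjoint (h : Admissible Φ X σ φ) (hd : Disjoint (FV φ) X) : msub σ φ = φ :=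
  msub_eq_self φ σ fun p hp => h.eq_var p (Set.disjoint_left.1 hd hp)

theorem disj_left (hcl : ∀ φ, FLClosure Φ φ → φ ∈ Φ) (h : Admissible Φ X σ (disj φ ψ)) :
    Admissible Φ X σ φ :=
  ⟨h.eq_var, h.mem, fun p hp => Set.subset_union_left.trans (h.bv p hp),
    hcl _ (.disj_left (.base h.msub_mem))⟩

theorem disj_right (hcl : ∀ φ, FLClosure Φ φ → φ ∈ Φ) (h : Admissible Φ X σ (disj φ ψ)) :
    Admissible Φ X σ ψ :=
  ⟨h.eq_var, h.mem, fun p hp => Set.subset_union_right.trans (h.bv p hp),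
    hcl _ (.disj_right (.base h.msub_mem))⟩

theorem conj_left (hcl : ∀ φ, FLClosure Φ φ → φ ∈ Φ) (h : Admissible Φ X σ (conj φ ψ)) :
    Admissible Φ X σ φ :=
  ⟨h.eq_var, h.mem, fun p hp => Set.subset_union_left.trans (h.bv p hp),
    hcl _ (.conj_left (.base h.msub_mem))⟩

theorem conj_right (hcl : ∀ φ, FLClosure Φ φ → φ ∈ Φ) (h : Admissible Φ X σ (conj φ ψ)) :
    Admissible Φ X σ ψ :=
  ⟨h.eq_var, h.mem, fun p hp => Set.subset_union_right.trans (h.bv p hp),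
    hcl _ (.conj_right (.base h.msub_mem))⟩

theorem dia (hcl : ∀ φ, FLClosure Φ φ → φ ∈ Φ) (h : Admissible Φ X σ (dia φ)) :
    Admissible Φ X σ φ :=
  ⟨h.eq_var, h.mem, h.bv, hcl _ (.dia (.base h.msub_mem))⟩

theorem box (hcl : ∀ φ, FLClosure Φ φ → φ ∈ Φ) (h : Admissible Φ X σ (box φ)) :
    Admissible Φ X σ φ :=
  ⟨h.eq_var, h.mem, h.bv, hcl _ (.box (.base h.msub_mem))⟩

/-- No `σ p` with `p ∈ X` has `y` free: `y` is bound in `σ p` by the field `bv`, and `σ p` is tidy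
as a member of `Φ`. With `χ` the instance of the fixpoint formula, the right side is its
FL-unfolding. -/
theorem msub_update (htidy : ∀ φ ∈ Φ, φ.Tidy) {η : FixOp} {y : P}
    (h : Admissible Φ X σ (fix η y φ)) (χ : Formula P) :
    msub (Function.update σ y χ) φ = subst y χ (msub (Function.update σ y (var y)) φ) := by
  rw [subst_msub, Function.update_idem]
  · exact Function.update_self ..
  · intro p hp
    rw [Function.update_of_ne hp]
    by_cases hX : p ∈ X
    · exact fun hy => Set.disjoint_left.1 (htidy _ (h.mem p hX)) hy
        (h.bv p hX (Set.mem_insert _ _))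
    · rw [h.eq_var p hX]
      exact fun e => hp e.symm

theorem fix (hcl : ∀ φ, FLClosure Φ φ → φ ∈ Φ) (htidy : ∀ φ ∈ Φ, φ.Tidy) {η : FixOp} {y : P}
    (h : Admissible Φ X σ (fix η y φ)) :
    Admissible Φ (X ∪ {y}) (Function.update σ y (msub σ (.fix η y φ))) φ where
  eq_var p hp := by
    rw [Function.update_of_ne fun e => hp (Or.inr e)]
    exact h.eq_var p fun hX => hp (Or.inl hX)
  mem p hp := by
    by_cases hpy : p = y
    · subst hpy; rw [Function.update_self]; exact h.msub_mem
    · rw [Function.update_of_ne hpy]; exact h.mem p (hp.resolve_right hpy)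
  bv p hp := by
    by_cases hpy : p = y
    · subst hpy
      rw [Function.update_self]
      exact (Set.subset_insert _ _).trans (BV_subset_msub (.fix η p φ) σ)
    · rw [Function.update_of_ne hpy]
      exact (Set.subset_insert _ _).trans (h.bv p (hp.resolve_right hpy))
  msub_mem := by
    rw [h.msub_update htidy]
    exact hcl _ (.unfold (.base h.msub_mem))

end Admissible

end Admissible

-- Filtration conditions and independence of representatives

section Filtration

variable {P : Type u} [DecidableEq P] {S : Type v} {Φ : Set (Formula P)}
  {M : KripkeModel P S} {N : KripkeModel P (FiltState M Φ)}

theorem sat_iff_of_cls_eq {s t : S} (h : cls M Φ s = cls M Φ t) {φ : Formula P} (hφ : φ ∈ Φ) :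
    M.Sat s φ ↔ M.Sat t φ :=
  Quotient.exact h φ hφ

theorem exists_cls (a : FiltState M Φ) : ∃ s, cls M Φ s = a := Quotient.exists_rep a

theorem IsFiltration.rel (hN : IsFiltration M Φ N) {s t : S} (h : M.R s t) :
    N.R (cls M Φ s) (cls M Φ t) :=
  hN.rmin_le _ _ ⟨s, t, rfl, rfl, h⟩

theorem IsFiltration.sat_of_box (hN : IsFiltration M Φ N) {s t : S}
    (h : N.R (cls M Φ s) (cls M Φ t)) {φ : Formula P} (hb : box φ ∈ Φ) (hφ : φ ∈ Φ)
    (hs : M.Sat s (box φ)) : M.Sat t φ := by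
  obtain ⟨s', t', hs', ht', H⟩ := hN.le_rmax _ _ h
  exact (sat_iff_of_cls_eq ht' hφ).1 (H φ hb ((sat_iff_of_cls_eq hs' hb).2 hs))

theorem IsFiltration.mem_val (hN : IsFiltration M Φ N) {p : P} (hp : var p ∈ Φ) (s : S) :
    cls M Φ s ∈ N.V p ↔ s ∈ M.V p := by
  rw [hN.val p hp]
  constructor
  · rintro ⟨t, ht, hs⟩
    exact (sat_iff_of_cls_eq ht hp).1 hs
  · exact fun hs => ⟨s, rfl, hs⟩

theorem sat_dia_of_rMaxDia (hR : ∀ a b, N.R a b → RMaxDia M Φ a b) {s t : S}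
    (h : N.R (cls M Φ s) (cls M Φ t)) {φ : Formula P} (hd : dia φ ∈ Φ) (hφ : φ ∈ Φ)
    (ht : M.Sat t φ) : M.Sat s (dia φ) := by
  obtain ⟨s', t', hs', ht', H⟩ := hR _ _ h
  exact (sat_iff_of_cls_eq hs' hd).1 (H φ hd ((sat_iff_of_cls_eq ht' hφ).2 ht))

/-- The diamond condition for `φ` is the contrapositive of the box condition for `neg φ`, and `box
(neg φ)` is the negation of `dia φ`. -/
theorem RMax.rMaxDia (hΦ : NegClosed Φ) {a b : FiltState M Φ} (h : RMax M Φ a b) :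
    RMaxDia M Φ a b := by
  obtain ⟨s, t, hs, ht, H⟩ := h
  refine ⟨s, t, hs, ht, fun φ hd hφ => ?_⟩
  by_contra hn
  exact (M.sat_neg t φ).1 (H (neg φ) (hΦ _ hd) ((M.sat_neg s (dia φ)).2 hn)) hφ

-- Truth passes from the model to the filtration

mutual

theorem IsMuC.sat_filtration (hcl : ∀ φ, FLClosure Φ φ → φ ∈ Φ) (htidy : ∀ φ ∈ Φ, φ.Tidy)
    (hunf : ∀ η y ψ, fix η y ψ ∈ Φ → ∀ s, M.Sat s (subst y (fix η y ψ) ψ) ↔ M.Sat s (fix η y ψ))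
    (hN : IsFiltration M Φ N) {φ : Formula P} :
    IsMuC φ → φ ∈ Φ → ∀ s, M.Sat s φ → N.Sat (cls M Φ s) φ
  | .var p => fun hΦ s hs => (hN.mem_val hΦ s).2 hs
  | .nvar p => fun hΦ s hs hn => hs ((hN.mem_val (hcl _ (.nvar (.base hΦ))) s).1 hn)
  | .disj h₁ h₂ => fun hΦ s hs => hs.imp
      (IsMuC.sat_filtration hcl htidy hunf hN h₁ (hcl _ (.disj_left (.base hΦ))) s)
      (IsMuC.sat_filtration hcl htidy hunf hN h₂ (hcl _ (.disj_right (.base hΦ))) s)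
  | .conj h₁ h₂ => fun hΦ s hs => hs.imp
      (IsMuC.sat_filtration hcl htidy hunf hN h₁ (hcl _ (.conj_left (.base hΦ))) s)
      (IsMuC.sat_filtration hcl htidy hunf hN h₂ (hcl _ (.conj_right (.base hΦ))) s)
  | .dia h => fun hΦ s ⟨t, hst, ht⟩ => ⟨_, hN.rel hst,
      IsMuC.sat_filtration hcl htidy hunf hN h (hcl _ (.dia (.base hΦ))) t ht⟩
  | .box h => fun hΦ s hs b hb => by
      obtain ⟨t, rfl⟩ := exists_cls b
      have hΦ' := hcl _ (.box (.base hΦ))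
      exact IsMuC.sat_filtration hcl htidy hunf hN h hΦ' t (hN.sat_of_box hb hΦ hΦ' hs)
  | .mu (x := x) (φ := φ) h => fun hΦ s hs Y hY => by
      have ha := (Admissible.of_mem hΦ).fix hcl htidy
      rw [Set.empty_union] at ha
      -- The preimage of the prefixpoint `Y` is a prefixpoint in the model.
      refine hs {s | cls M Φ s ∈ Y} fun t ht => hY ?_
      refine IsCon.sat_filtration hcl htidy hunf hN h _ ha _ _ (fun p hp => ?_) (fun p hp => ?_)
        (fun p hp t ht => ?_) t ht
      · exact Function.update_of_ne hp _ _
      · exact Function.update_of_ne hp _ _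
      · obtain rfl : p = x := hp
        simpa using ht
  | .nu (x := x) (φ := φ) h => fun hΦ s hs => by
      have ha := (Admissible.of_mem hΦ).fix hcl htidy
      rw [Set.empty_union] at ha
      -- The image of the truth set serves as a postfixpoint in the filtration.
      refine ⟨cls M Φ '' {s | M.Sat s (fix .nu x φ)}, ?_, s, hs, rfl⟩
      rintro _ ⟨t, ht, rfl⟩
      refine IsCocon.sat_filtration hcl htidy hunf hN h _ ha _ (fun p hp => ?_)
        (fun p hp t ht => ?_) t ?_
      · exact Function.update_of_ne hp _ _
      · obtain rfl : p = x := hp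
        rw [Function.update_self, msub_eq_self _ _ fun _ _ => rfl] at ht
        rw [Function.update_self]
        exact ⟨t, ht, rfl⟩
      -- At the outermost binder `σ` is `var`, so the instance of the body is the plain unfolding.
      · rw [(Admissible.of_mem hΦ).msub_update htidy, msub_eq_self _ var fun _ _ => rfl,
          Function.update_eq_self, msub_eq_self _ var fun _ _ => rfl]
        exact (hunf _ _ _ hΦ t).2 ht

/-- The valuations on `X` are related only by inclusion along `cls`, since they come from arbitrary
prefixpoints. `σ` plays no role in the meaning; it only certifies that the leaves free of `X` lie in
`Φ`. -/
theorem IsCon.sat_filtration (hcl : ∀ φ, FLClosure Φ φ → φ ∈ Φ) (htidy : ∀ φ ∈ Φ, φ.Tidy)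
    (hunf : ∀ η y ψ, fix η y ψ ∈ Φ → ∀ s, M.Sat s (subst y (fix η y ψ) ψ) ↔ M.Sat s (fix η y ψ))
    (hN : IsFiltration M Φ N) {X : Set P} {φ : Formula P} :
    IsCon X φ → ∀ σ, Admissible Φ X σ φ → ∀ V W, (∀ p ∉ X, V p = M.V p) → (∀ p ∉ X, W p = N.V p) →
      (∀ p ∈ X, ∀ s, s ∈ V p → cls M Φ s ∈ W p) →
      ∀ s, s ∈ meaning M.R φ V → cls M Φ s ∈ meaning N.R φ W
  | .var hx => fun _ _ _ _ _ _ hX s hs => hX _ hx s hs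
  | .free h hd => fun σ ha V W hV hW _ s hs => by
      have hΦ := ha.msub_mem
      rw [ha.msub_eq_of_disjoint hd] at hΦ
      rw [meaning_congr _ _ _ _ fun p hp => hW p (Set.disjoint_left.1 hd hp)]
      rw [meaning_congr _ _ _ _ fun p hp => hV p (Set.disjoint_left.1 hd hp)] at hs
      exact IsMuC.sat_filtration hcl htidy hunf hN h hΦ s hs
  | .disj h₁ h₂ => fun σ ha V W hV hW hX s hs => hs.imp
      (IsCon.sat_filtration hcl htidy hunf hN h₁ σ (ha.disj_left hcl) V W hV hW hX s)
      (IsCon.sat_filtration hcl htidy hunf hN h₂ σ (ha.disj_right hcl) V W hV hW hX s)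
  | .conj h₁ h₂ => fun σ ha V W hV hW hX s hs => hs.imp
      (IsCon.sat_filtration hcl htidy hunf hN h₁ σ (ha.conj_left hcl) V W hV hW hX s)
      (IsCon.sat_filtration hcl htidy hunf hN h₂ σ (ha.conj_right hcl) V W hV hW hX s)
  | .dia h => fun σ ha V W hV hW hX s ⟨t, hst, ht⟩ => ⟨_, hN.rel hst,
      IsCon.sat_filtration hcl htidy hunf hN h σ (ha.dia hcl) V W hV hW hX t ht⟩
  | .mu (y := y) h => fun σ ha V W hV hW hX s hs Y hY => by
      refine hs {s | cls M Φ s ∈ Y} fun t ht => hY ?_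
      refine IsCon.sat_filtration hcl htidy hunf hN h _ (ha.fix hcl htidy) _ _ (fun p hp => ?_)
        (fun p hp => ?_) (fun p hp t ht => ?_) t ht
      · rw [Function.update_of_ne fun e => hp (Or.inr e)]
        exact hV p fun h => hp (Or.inl h)
      · rw [Function.update_of_ne fun e => hp (Or.inr e)]
        exact hW p fun h => hp (Or.inl h)
      · by_cases hpy : p = y
        · subst hpy
          simpa using ht
        · rw [Function.update_of_ne hpy] at ht ⊢
          exact hX p (hp.resolve_right hpy) t ht

/-- On the model side the variables of `X` stand for the formulas `σ p`, not for arbitrary sets. In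
the box case this puts the boxed instance in `Φ`, where `RMax` applies to it. -/
theorem IsCocon.sat_filtration (hcl : ∀ φ, FLClosure Φ φ → φ ∈ Φ) (htidy : ∀ φ ∈ Φ, φ.Tidy)
    (hunf : ∀ η y ψ, fix η y ψ ∈ Φ → ∀ s, M.Sat s (subst y (fix η y ψ) ψ) ↔ M.Sat s (fix η y ψ))
    (hN : IsFiltration M Φ N) {X : Set P} {φ : Formula P} :
    IsCocon X φ → ∀ σ, Admissible Φ X σ φ → ∀ W, (∀ p ∉ X, W p = N.V p) →
      (∀ p ∈ X, ∀ s, M.Sat s (σ p) → cls M Φ s ∈ W p) →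
      ∀ s, M.Sat s (msub σ φ) → cls M Φ s ∈ meaning N.R φ W
  | .var hx => fun _ _ _ _ hX s hs => hX _ hx s hs
  | .free h hd => fun σ ha W hW _ s hs => by
      have hΦ := ha.msub_mem
      rw [ha.msub_eq_of_disjoint hd] at hΦ hs
      rw [meaning_congr _ _ _ _ fun p hp => hW p (Set.disjoint_left.1 hd hp)]
      exact IsMuC.sat_filtration hcl htidy hunf hN h hΦ s hs
  | .disj h₁ h₂ => fun σ ha W hW hX s hs => hs.imp
      (IsCocon.sat_filtration hcl htidy hunf hN h₁ σ (ha.disj_left hcl) W hW hX s)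
      (IsCocon.sat_filtration hcl htidy hunf hN h₂ σ (ha.disj_right hcl) W hW hX s)
  | .conj h₁ h₂ => fun σ ha W hW hX s hs => hs.imp
      (IsCocon.sat_filtration hcl htidy hunf hN h₁ σ (ha.conj_left hcl) W hW hX s)
      (IsCocon.sat_filtration hcl htidy hunf hN h₂ σ (ha.conj_right hcl) W hW hX s)
  | .box h => fun σ ha W hW hX s hs b hb => by
      obtain ⟨t, rfl⟩ := exists_cls b
      exact IsCocon.sat_filtration hcl htidy hunf hN h σ (ha.box hcl) W hW hX t
        (hN.sat_of_box hb ha.msub_mem (ha.box hcl).msub_mem hs)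
  | .nu (y := y) (φ := φ) h => fun σ ha W hW hX s hs => by
      refine ⟨cls M Φ '' {s | M.Sat s (msub σ (fix .nu y φ))}, ?_, s, hs, rfl⟩
      rintro _ ⟨t, ht, rfl⟩
      refine IsCocon.sat_filtration hcl htidy hunf hN h _ (ha.fix hcl htidy) _ (fun p hp => ?_)
        (fun p hp t ht => ?_) t ?_
      · rw [Function.update_of_ne fun e => hp (Or.inr e)]
        exact hW p fun h => hp (Or.inl h)
      · by_cases hpy : p = y
        · subst hpy
          rw [Function.update_self] at ht ⊢
          exact ⟨t, ht, rfl⟩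
        · rw [Function.update_of_ne hpy] at ht ⊢
          exact hX p (hp.resolve_right hpy) t ht
      · rw [ha.msub_update htidy]
        exact (hunf _ _ _ ha.msub_mem t).2 ht

end

-- Truth passes back from the filtration to the model

mutual

theorem IsMuC.sat_of_filtration (hcl : ∀ φ, FLClosure Φ φ → φ ∈ Φ) (htidy : ∀ φ ∈ Φ, φ.Tidy)
    (hunf : ∀ η y ψ, fix η y ψ ∈ Φ → ∀ s, M.Sat s (subst y (fix η y ψ) ψ) ↔ M.Sat s (fix η y ψ))
    (hN : IsFiltration M Φ N) (hR : ∀ a b, N.R a b → RMaxDia M Φ a b) {φ : Formula P} :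
    IsMuC φ → φ ∈ Φ → ∀ s, N.Sat (cls M Φ s) φ → M.Sat s φ
  | .var p => fun hΦ s hs => (hN.mem_val hΦ s).1 hs
  | .nvar p => fun hΦ s hs hn => hs ((hN.mem_val (hcl _ (.nvar (.base hΦ))) s).2 hn)
  | .disj h₁ h₂ => fun hΦ s hs => hs.imp
      (IsMuC.sat_of_filtration hcl htidy hunf hN hR h₁ (hcl _ (.disj_left (.base hΦ))) s)
      (IsMuC.sat_of_filtration hcl htidy hunf hN hR h₂ (hcl _ (.disj_right (.base hΦ))) s)
  | .conj h₁ h₂ => fun hΦ s hs => hs.imp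
      (IsMuC.sat_of_filtration hcl htidy hunf hN hR h₁ (hcl _ (.conj_left (.base hΦ))) s)
      (IsMuC.sat_of_filtration hcl htidy hunf hN hR h₂ (hcl _ (.conj_right (.base hΦ))) s)
  | .dia h => fun hΦ s ⟨b, hb, hs⟩ => by
      obtain ⟨t, rfl⟩ := exists_cls b
      have hΦ' := hcl _ (.dia (.base hΦ))
      exact sat_dia_of_rMaxDia hR hb hΦ hΦ'
        (IsMuC.sat_of_filtration hcl htidy hunf hN hR h hΦ' t hs)
  | .box h => fun hΦ s hs t hst =>
      IsMuC.sat_of_filtration hcl htidy hunf hN hR h (hcl _ (.box (.base hΦ))) t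
        (hs _ (hN.rel hst))
  | .mu (x := x) (φ := φ) h => fun hΦ s hs => by
      have ha := (Admissible.of_mem hΦ).fix hcl htidy
      rw [Set.empty_union] at ha
      -- The truth set is a union of classes because the fixpoint formula lies in `Φ`, so passing to
      -- the image loses nothing.
      have hT : ∀ t, cls M Φ t ∈ cls M Φ '' {s | M.Sat s (fix .mu x φ)} →
          M.Sat t (fix .mu x φ) := by
        rintro t ⟨t', ht', e⟩
        exact (sat_iff_of_cls_eq e hΦ).1 ht'
      refine hT s (hs _ fun b hb => ?_)
      obtain ⟨t, rfl⟩ := exists_cls b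
      refine ⟨t, (hunf _ _ _ hΦ t).1 ?_, rfl⟩
      have key := IsCon.sat_of_filtration hcl htidy hunf hN hR h _ ha _ (fun p hp => ?_)
        (fun p hp t ht => ?_) t hb
      · rwa [(Admissible.of_mem hΦ).msub_update htidy, msub_eq_self _ var fun _ _ => rfl,
          Function.update_eq_self, msub_eq_self _ var fun _ _ => rfl] at key
      · exact Function.update_of_ne hp _ _
      · obtain rfl : p = x := hp
        rw [Function.update_self] at ht
        rw [Function.update_self, msub_eq_self _ _ fun _ _ => rfl]
        exact hT t ht
  | .nu (x := x) (φ := φ) h => fun hΦ s ⟨Y, hY, hs⟩ => by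
      have ha := (Admissible.of_mem hΦ).fix hcl htidy
      rw [Set.empty_union] at ha
      -- The preimage of the postfixpoint `Y` is a postfixpoint in the model.
      refine ⟨{s | cls M Φ s ∈ Y}, fun t ht => ?_, hs⟩
      refine IsCocon.sat_of_filtration hcl htidy hunf hN hR h _ ha _ _ (fun p hp => ?_)
        (fun p hp => ?_) (fun p hp t ht => ?_) t (hY ht)
      · exact Function.update_of_ne hp _ _
      · exact Function.update_of_ne hp _ _
      · obtain rfl : p = x := hp
        simpa using ht

/-- Dual to `IsCocon.sat_filtration`: the diamond case applies `RMaxDia` to an instance lying in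
`Φ`. -/
theorem IsCon.sat_of_filtration (hcl : ∀ φ, FLClosure Φ φ → φ ∈ Φ) (htidy : ∀ φ ∈ Φ, φ.Tidy)
    (hunf : ∀ η y ψ, fix η y ψ ∈ Φ → ∀ s, M.Sat s (subst y (fix η y ψ) ψ) ↔ M.Sat s (fix η y ψ))
    (hN : IsFiltration M Φ N) (hR : ∀ a b, N.R a b → RMaxDia M Φ a b) {X : Set P}
    {φ : Formula P} :
    IsCon X φ → ∀ σ, Admissible Φ X σ φ → ∀ W, (∀ p ∉ X, W p = N.V p) →
      (∀ p ∈ X, ∀ s, cls M Φ s ∈ W p → M.Sat s (σ p)) →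
      ∀ s, cls M Φ s ∈ meaning N.R φ W → M.Sat s (msub σ φ)
  | .var hx => fun _ _ _ _ hX s hs => hX _ hx s hs
  | .free h hd => fun σ ha W hW _ s hs => by
      have hΦ := ha.msub_mem
      rw [ha.msub_eq_of_disjoint hd] at hΦ ⊢
      rw [meaning_congr _ _ _ _ fun p hp => hW p (Set.disjoint_left.1 hd hp)] at hs
      exact IsMuC.sat_of_filtration hcl htidy hunf hN hR h hΦ s hs
  | .disj h₁ h₂ => fun σ ha W hW hX s hs => hs.imp
      (IsCon.sat_of_filtration hcl htidy hunf hN hR h₁ σ (ha.disj_left hcl) W hW hX s)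
      (IsCon.sat_of_filtration hcl htidy hunf hN hR h₂ σ (ha.disj_right hcl) W hW hX s)
  | .conj h₁ h₂ => fun σ ha W hW hX s hs => hs.imp
      (IsCon.sat_of_filtration hcl htidy hunf hN hR h₁ σ (ha.conj_left hcl) W hW hX s)
      (IsCon.sat_of_filtration hcl htidy hunf hN hR h₂ σ (ha.conj_right hcl) W hW hX s)
  | .dia h => fun σ ha W hW hX s ⟨b, hb, hs⟩ => by
      obtain ⟨t, rfl⟩ := exists_cls b
      exact sat_dia_of_rMaxDia hR hb ha.msub_mem (ha.dia hcl).msub_mem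
        (IsCon.sat_of_filtration hcl htidy hunf hN hR h σ (ha.dia hcl) W hW hX t hs)
  | .mu (y := y) (φ := φ) h => fun σ ha W hW hX s hs => by
      have hT : ∀ t, cls M Φ t ∈ cls M Φ '' {s | M.Sat s (msub σ (fix .mu y φ))} →
          M.Sat t (msub σ (fix .mu y φ)) := by
        rintro t ⟨t', ht', e⟩
        exact (sat_iff_of_cls_eq e ha.msub_mem).1 ht'
      refine hT s (hs _ fun b hb => ?_)
      obtain ⟨t, rfl⟩ := exists_cls b
      refine ⟨t, (hunf _ _ _ ha.msub_mem t).1 ?_, rfl⟩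
      have key := IsCon.sat_of_filtration hcl htidy hunf hN hR h _ (ha.fix hcl htidy) _
        (fun p hp => ?_) (fun p hp t ht => ?_) t hb
      · rwa [ha.msub_update htidy] at key
      · rw [Function.update_of_ne fun e => hp (Or.inr e)]
        exact hW p fun h => hp (Or.inl h)
      · by_cases hpy : p = y
        · subst hpy
          rw [Function.update_self] at ht ⊢
          exact hT t ht
        · rw [Function.update_of_ne hpy] at ht ⊢
          exact hX p (hp.resolve_right hpy) t ht

/-- Dual to `IsCon.sat_filtration`: arbitrary valuations suffice because the box case uses only
`RMin`. -/
theorem IsCocon.sat_of_filtration (hcl : ∀ φ, FLClosure Φ φ → φ ∈ Φ) (htidy : ∀ φ ∈ Φ, φ.Tidy)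
    (hunf : ∀ η y ψ, fix η y ψ ∈ Φ → ∀ s, M.Sat s (subst y (fix η y ψ) ψ) ↔ M.Sat s (fix η y ψ))
    (hN : IsFiltration M Φ N) (hR : ∀ a b, N.R a b → RMaxDia M Φ a b) {X : Set P}
    {φ : Formula P} :
    IsCocon X φ → ∀ σ, Admissible Φ X σ φ → ∀ V W, (∀ p ∉ X, V p = M.V p) →
      (∀ p ∉ X, W p = N.V p) → (∀ p ∈ X, ∀ s, cls M Φ s ∈ W p → s ∈ V p) →
      ∀ s, cls M Φ s ∈ meaning N.R φ W → s ∈ meaning M.R φ V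
  | .var hx => fun _ _ _ _ _ _ hX s hs => hX _ hx s hs
  | .free h hd => fun σ ha V W hV hW _ s hs => by
      have hΦ := ha.msub_mem
      rw [ha.msub_eq_of_disjoint hd] at hΦ
      rw [meaning_congr _ _ _ _ fun p hp => hW p (Set.disjoint_left.1 hd hp)] at hs
      rw [meaning_congr _ _ _ _ fun p hp => hV p (Set.disjoint_left.1 hd hp)]
      exact IsMuC.sat_of_filtration hcl htidy hunf hN hR h hΦ s hs
  | .disj h₁ h₂ => fun σ ha V W hV hW hX s hs => hs.imp
      (IsCocon.sat_of_filtration hcl htidy hunf hN hR h₁ σ (ha.disj_left hcl) V W hV hW hX s)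
      (IsCocon.sat_of_filtration hcl htidy hunf hN hR h₂ σ (ha.disj_right hcl) V W hV hW hX s)
  | .conj h₁ h₂ => fun σ ha V W hV hW hX s hs => hs.imp
      (IsCocon.sat_of_filtration hcl htidy hunf hN hR h₁ σ (ha.conj_left hcl) V W hV hW hX s)
      (IsCocon.sat_of_filtration hcl htidy hunf hN hR h₂ σ (ha.conj_right hcl) V W hV hW hX s)
  | .box h => fun σ ha V W hV hW hX s hs t hst =>
      IsCocon.sat_of_filtration hcl htidy hunf hN hR h σ (ha.box hcl) V W hV hW hX t
        (hs _ (hN.rel hst))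
  | .nu (y := y) h => fun σ ha V W hV hW hX s ⟨Y, hY, hs⟩ => by
      refine ⟨{s | cls M Φ s ∈ Y}, fun t ht => ?_, hs⟩
      refine IsCocon.sat_of_filtration hcl htidy hunf hN hR h _ (ha.fix hcl htidy) _ _
        (fun p hp => ?_) (fun p hp => ?_) (fun p hp t ht => ?_) t (hY ht)
      · rw [Function.update_of_ne fun e => hp (Or.inr e)]
        exact hV p fun h => hp (Or.inl h)
      · rw [Function.update_of_ne fun e => hp (Or.inr e)]
        exact hW p fun h => hp (Or.inl h)
      · by_cases hpy : p = y
        · subst hpy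
          simpa using ht
        · rw [Function.update_of_ne hpy] at ht ⊢
          exact hX p (hp.resolve_right hpy) t ht

end

end Filtration

end MuCalc

theorem mainTheorem1 {P : Type*} [DecidableEq P] [Countable P] [Infinite P]
    (Φ : Set (MuCalc.Formula P)) (hfin : Φ.Finite) (hcl : MuCalc.FLClosed Φ)
    (hmu : ∀ φ ∈ Φ, MuCalc.IsMuC φ) (htidy : ∀ φ ∈ Φ, φ.Tidy)
    {S : Type*} (M : MuCalc.KripkeModel P S)
    (N : MuCalc.KripkeModel P (MuCalc.FiltState M Φ)) (hN : MuCalc.IsFiltration M Φ N)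
    (ξ : MuCalc.Formula P) (hξ : ξ ∈ Φ) (hclean : ξ.Clean) :
    (∀ s : S, M.Sat s ξ → N.Sat (MuCalc.cls M Φ s) ξ) ∧
    ((MuCalc.NegClosed Φ ∨ ∀ a b, N.R a b → MuCalc.RMaxDia M Φ a b) →
      ∀ s : S, M.Sat s ξ ↔ N.Sat (MuCalc.cls M Φ s) ξ) := by
  have hcl' : ∀ φ, MuCalc.FLClosure Φ φ → φ ∈ Φ := fun φ h => hcl.subset h
  -- Membership in the fragment makes the bound variable positive, and tidiness rules out capture.
  have hunf : ∀ η y ψ, MuCalc.Formula.fix η y ψ ∈ Φ → ∀ s,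
      M.Sat s (MuCalc.Formula.subst y (.fix η y ψ) ψ) ↔ M.Sat s (.fix η y ψ) := by
    intro η y ψ h s
    unfold MuCalc.KripkeModel.Sat
    rw [MuCalc.meaning_unfold M.R η y ψ (hmu _ h).posIn (htidy _ h)]
  have hfwd := (hmu ξ hξ).sat_filtration hcl' htidy hunf hN hξ
  refine ⟨hfwd, fun hor s => ⟨hfwd s, ?_⟩⟩
  have hR : ∀ a b, N.R a b → MuCalc.RMaxDia M Φ a b :=
    hor.elim (fun hneg a b h => (hN.le_rmax a b h).rMaxDia hneg) id
  exact (hmu ξ hξ).sat_of_filtration hcl' htidy hunf hN hR hξ s
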